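/- **Setting.** A correlated bandit with $K$ arms (channels) has known reward functions $Y_1,\dots,Y_K:\mathcal X\to\{0,1\}$ of a hidden state $X$; an instance is a law of $X$. In each slot $t\ge 1$ a scheduling policy $\rho$ picks an arm $k_t$ (possibly at random, from the past observations) and observes $Y_{k_t}(X_t)$, where $X_1,X_2,\dots$ are i.i.d. copies of $X$; value $1$ means that the update succeeds. Let $P_k$ be the law of $Y_k(X)$, $\mu_k=\mathbb E[Y_k(X)]$, $\mu^*=\max_k\mu_k>0$, $\Delta_k=\mu^*-\mu_k$, and suppose that the optimal arm $k^*$ is unique. The pseudo gap of arm $k$ is $\tilde\Delta_{k,k^*}=\mu^*-\mathbb E[s_{k,k^*}(Y_{k^*}(X))]$ with $s_{k,k^*}(r)=\sup_{x:\,Y_{k^*}(x)=r}Y_k(x)$, and $\mathcal C'=\{k:\tilde\Delta_{k,k^*}<0\}$ is the set of strictly competitive arms. The age of information satisfies $a(t+1)=1$ if the update in slot $t$ succeeds and $a(t+1)=a(t)+1$ otherwise; $a(1)$ has the stationary law of the age under the constant choice of $k^*$ (geometric with parameter $\mu^*$), and policies may also observe $a(1)$. The AoI regret is $R_\rho(T)=\sum_{t=1}^T\mathbb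 E[a_\rho(t)]-T/\mu^*$. For $\alpha\in(0,1)$, a policy is $\alpha$-consistent if for every law of $X$ there is a constant $M$ such that $\mathbb E[\sum_{s=1}^t\mathbf 1\{k_s=k\}]\le Mt^\alpha$ for every sub-optimal arm $k$ and every $t$. Call a law $X'$ of the state a perturbation in favour of arm $k$ if, with $P'_k$ the law of $Y_k(X')$, $\mathbb E[Y_k(X')]>\mu^*$, $\mathbb E[Y_k(X')]>\mathbb E[Y_{k^*}(X')]$ and the Kullback-Leibler divergence $D(P_k,P'_k)$ is finite. **Theorem (lower bound on AoI regret).** (i) Suppose that $\mathcal C'\neq\emptyset$. Then there are perturbations $X'_k$ in favour of $k$, for $k\in\mathcal C'$, which depend only on the instance, such that for every $\alpha\in(0,1)$ and every $\alpha$-consistent policy $\rho$ there is a constant $M>0$ (independent of $T$) with $\mathbb E[\sum_{s=1}^t\mathbf 1\{k_s=k\}]\le Mt^\alpha$ for all $t$ and all $k\ne k^*$, and $$R_\rho(T)\ \ge\ \max_{k\in\mathcal C'}\frac{\Delta_k}{D(P_k,P'_k)}\cdot\frac{(1-\alpha)\log T-\log(4M)}{\mu^*}\qquad\text{for all }T\ge1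 .$$ If $K=2$, the perturbations can be chosen so that they leave the reward distribution of $k^*$ unchanged. For any $K$, the same bound holds (with $M$ depending on the choice) if any of the $X'_k$ are replaced by arbitrary perturbations in favour of $k$ that leave the reward distributions of all arms other than $k$ unchanged. In particular $R_\rho(T)=\Omega(\log T)$ for every $\alpha$-consistent $\rho$. (ii) If $\tilde\Delta_{k,k^*}\ge0$ for all $k$, then $R_\rho(T)\ge0$ for every policy $\rho$ and every $T$. -/

import Mathlib

open MeasureTheory ProbabilityTheory Filter
open scoped ENNReal

noncomputable section

/-- The known part of a correlated bandit with `K` arms: the reward functions `Y k`, which map the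
hidden state to the success (`true`) or failure (`false`) of arm `k`. -/
structure RewardFunctions (K : ℕ) (S : Type*) [MeasurableSpace S] where
  Y : Fin K → S → Bool
  measurable_Y : ∀ k, Measurable (Y k)

/-- The numerical value of a reward: `1` for a success, `0` for a failure. -/
def rewardValue (b : Bool) : ℝ := if b then 1 else 0

namespace RewardFunctions

variable {K : ℕ} {S : Type*} [MeasurableSpace S] (B : RewardFunctions K S)

/-! A correlated bandit instance is given by the reward functions `B` and a law `P` of the hidden
state `X`. -/

/-- `μ k = E[Y k (X)]`. -/
def mean (P : ProbabilityMeasure S) (k : Fin K) : ℝ := ∫ x, rewardValue (B.Y k x) ∂(P : Measure S)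

/-- `μ* = max_k μ k`. -/
def bestMean (P : ProbabilityMeasure S) : ℝ := ⨆ k, B.mean P k

/-- The sub-optimality gap `Δ k = μ* - μ k`. -/
def gap (P : ProbabilityMeasure S) (k : Fin K) : ℝ := B.bestMean P - B.mean P k

/-- `kstar` is the (unique) optimal arm. -/
def IsOptimalArm (P : ProbabilityMeasure S) (kstar : Fin K) : Prop :=
  ∀ k, k ≠ kstar → B.mean P k < B.mean P kstar

/-- The pseudo reward `s_{l,k}(r) = sup_{x : Y k x = r} Y l x`. -/
def pseudoReward (l k : Fin K) (r : Bool) : ℝ := ⨆ x : {x : S // B.Y k x = r}, rewardValue (B.Y l x)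

/-- The expected pseudo reward `φ_{l,k} = E[s_{l,k}(Y k (X))]`. -/
def expectedPseudoReward (P : ProbabilityMeasure S) (l k : Fin K) : ℝ :=
  ∫ x, B.pseudoReward l k (B.Y k x) ∂(P : Measure S)

/-- The pseudo gap of arm `l` with respect to arm `k`: `μ* - φ_{l,k}`. -/
def pseudoGap (P : ProbabilityMeasure S) (l k : Fin K) : ℝ :=
  B.bestMean P - B.expectedPseudoReward P l k

open Classical in
/-- The set of strictly competitive arms. -/
def strictlyCompetitive (P : ProbabilityMeasure S) (kstar : Fin K) : Finset (Fin K) :=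
  Finset.univ.filter fun k => B.pseudoGap P k kstar < 0

/-- The distribution of the reward of arm `k`. -/
def rewardLaw (P : ProbabilityMeasure S) (k : Fin K) : Measure Bool := (P : Measure S).map (B.Y k)

instance (P : ProbabilityMeasure S) (k : Fin K) : IsProbabilityMeasure (B.rewardLaw P k) :=
  Measure.isProbabilityMeasure_map (B.measurable_Y k).aemeasurable

/-- The Kullback-Leibler divergence of the reward distributions of arm `k` under the state laws
`P` and `Q`. -/
def rewardDiv (P Q : ProbabilityMeasure S) (k : Fin K) : ℝ≥0∞ :=
  InformationTheory.klDiv (B.rewardLaw P k) (B.rewardLaw Q k)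

/-- `Q` is a perturbation of the state law `P` in favour of arm `k`: under `Q` the mean reward of
arm `k` exceeds the optimal mean reward `μ*` under `P`, and arm `k` is better than `kstar`; the
divergence of the reward distributions of arm `k` is finite. -/
def IsPerturbation (P : ProbabilityMeasure S) (kstar k : Fin K) (Q : ProbabilityMeasure S) : Prop :=
  B.bestMean P < B.mean Q k ∧ B.mean Q kstar < B.mean Q k ∧ B.rewardDiv P Q k ≠ ∞

/-- Changing the state law from `P` to `Q` affects the reward distribution of no arm but `k`. -/
def AffectsOnly (P : ProbabilityMeasure S) (k : Fin K) (Q : ProbabilityMeasure S) : Prop :=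
  ∀ i, i ≠ k → B.rewardLaw Q i = B.rewardLaw P i

lemma mean_mem_Icc (P : ProbabilityMeasure S) (k : Fin K) : B.mean P k ∈ Set.Icc (0 : ℝ) 1 := by
  have h0 : ∀ x, 0 ≤ rewardValue (B.Y k x) := fun x => by unfold rewardValue; split_ifs <;> simp
  have h1 : ∀ x, rewardValue (B.Y k x) ≤ 1 := fun x => by unfold rewardValue; split_ifs <;> simp
  refine ⟨integral_nonneg h0, ?_⟩
  have := integral_mono_of_nonneg (μ := (P : Measure S)) (Eventually.of_forall h0)
    (integrable_const (1 : ℝ)) (Eventually.of_forall h1)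
  simpa [mean] using this

lemma bestMean_mem_unitInterval (P : ProbabilityMeasure S) : B.bestMean P ∈ unitInterval :=
  ⟨Real.iSup_nonneg fun k => (B.mean_mem_Icc P k).1,
    Real.iSup_le (fun k => (B.mean_mem_Icc P k).2) zero_le_one⟩

end RewardFunctions

/-- The observations up to some time slot, newest first: the scheduled arms, each with the success
or failure of the update. -/
abbrev History (K : ℕ) := List (Fin K × Bool)

/-- A (randomized, causal) scheduling policy: the distribution of the next arm, given the age of
information at the start of slot `1` and all the observations so far. -/
abbrev Policy (K : ℕ) := ℕ → History K → PMF (Fin K)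

/-- The age of information after the history `h`, when it was `a` at the start of slot `1`. It is
reset to `1` by a success, and it grows by `1` otherwise. -/
def age {K : ℕ} (a : ℕ) : History K → ℕ
  | [] => a
  | (_, y) :: h => if y then 1 else age a h + 1

/-- The number of times that arm `k` is scheduled in the history `h`. -/
def pulls {K : ℕ} (k : Fin K) (h : History K) : ℕ := (h.map Prod.fst).count k

/-- The expectation of an `ℕ`-valued random variable (finite for the age and for the number of
pulls whenever `μ* > 0`). -/
def pmfExpectation {Ω : Type*} (p : PMF Ω) (f : Ω → ℕ) : ℝ := (∑' ω, p ω * (f ω : ℝ≥0∞)).toReal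

namespace RewardFunctions

variable {K : ℕ} {S : Type*} [MeasurableSpace S] (B : RewardFunctions K S)

/-- The law of the age at the start of slot `1`: the stationary law of the age under the oracle's
policy, that is the geometric distribution on `{1, 2, …}` with parameter `μ*`. -/
def initialAge (P : ProbabilityMeasure S) : PMF ℕ :=
  (geometricMeasure ⟨B.bestMean P, B.bestMean_mem_unitInterval P⟩).toPMF.map (· + 1)

/-- The joint law of the initial age and of the observations in the slots `1, …, t` under the
policy `ρ`: in each slot an arm is drawn from the policy, and its reward is that of a fresh
independent copy of the state. -/
def trajectory (P : ProbabilityMeasure S) (ρ : Policy K) : ℕ → PMF (ℕ × History K)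
  | 0 => (B.initialAge P).map fun a => (a, [])
  | t + 1 => (trajectory P ρ t).bind fun ω => (ρ ω.1 ω.2).bind fun k =>
      (B.rewardLaw P k).toPMF.map fun y => (ω.1, (k, y) :: ω.2)

/-- The expected number of times that arm `k` is scheduled in the slots `1, …, t`. -/
def expectedPulls (P : ProbabilityMeasure S) (ρ : Policy K) (k : Fin K) (t : ℕ) : ℝ :=
  pmfExpectation (B.trajectory P ρ t) fun ω => pulls k ω.2

/-- The expected age after `t` slots, that is at the start of slot `t + 1`. -/
def expectedAge (P : ProbabilityMeasure S) (ρ : Policy K) (t : ℕ) : ℝ :=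
  pmfExpectation (B.trajectory P ρ t) fun ω => age ω.1 ω.2

/-- The AoI regret `R(T) = ∑_{t=1}^T E[a(t)] - T / μ*`. -/
def aoiRegret (P : ProbabilityMeasure S) (ρ : Policy K) (T : ℕ) : ℝ :=
  (∑ t ∈ Finset.range T, B.expectedAge P ρ t) - T / B.bestMean P

/-- `M` is a constant for which the policy schedules each sub-optimal arm at most `M * t ^ α` times
in expectation in the first `t` slots, on the instance with state law `P`. -/
def IsConsistencyConstant (P : ProbabilityMeasure S) (ρ : Policy K) (α M : ℝ) : Prop :=
  ∀ k, 0 < B.gap P k → ∀ t : ℕ, B.expectedPulls P ρ k t ≤ M * (t : ℝ) ^ α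

/-- `α`-consistent policies: `α ∈ (0, 1)`, and on every instance (the law of the state is unknown to
the policy) there is an instance dependent constant `M`. -/
def IsConsistent (ρ : Policy K) (α : ℝ) : Prop :=
  0 < α ∧ α < 1 ∧ ∀ P : ProbabilityMeasure S, ∃ M : ℝ, B.IsConsistencyConstant P ρ α M

end RewardFunctions

end

/-! Pulling a sub-optimal arm `k` raises the next expected age by `Δ k` times the current age, hence
by at least `Δ k`. With `e(t)` the excess of the expected age over its stationary value `1/μ*` and
`W(t)` the gap-weighted expected pulls, `e(t+1) ≥ (1-μ*) e(t) + W(t+1) - W(t)`. Since `e(0) = 0`,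
`e` stays nonnegative, so the regret is nonnegative and monotone, and summing gives `W(t) ≤ μ* R(t)
+ e(t)` (`weightedPulls_le`). The boundary term is removed by looking at the slots in `[T/2, T)`: if
`e ≥ 1` throughout, the regret is linear; otherwise some slot has `e ≤ 1` (`sub_le_aoiRegret_or`).

A logarithmic lower bound on pulls comes from a change of measure. A consistent policy pulls `kstar`
almost always under `P` but rarely under a law `Q` that makes `kstar` sub-optimal, so the total
information `∑ D k * E[pulls k]` is at least `(1-α) log t - C`
(`log_le_sum_rewardDiv_mul_expectedPulls`). The initial age, visible to the policy and with a law
that depends on the instance, costs only a constant.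

A negative pseudo gap yields a law that favours `k` and keeps the reward law of `kstar`
(`exists_rewardLaw_eq_of_pseudoGap_neg`). Information then comes only from arms with positive gap,
so the regret is at least a constant `c > 0` times the logarithmic term, up to the factor `1/μ*`. If
`K = 2`, this law affects `k` alone and the coefficient is `Δ k / D`. If `K ≠ 2`, it may affect
other arms; the perturbation is instead chosen with `D` so large that `Δ k / D ≤ c`
(`exists_isPerturbation_le_rewardDiv`), and the bound with constant `c` suffices. -/

/-! ### Expectations over histories with a fixed initial age -/

/-- The expectation of `g k y` for an arm `k` with law `π` and its reward `y` with law `r k`. -/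
noncomputable def slotExp {K : ℕ} (r : Fin K → PMF Bool) (π : PMF (Fin K))
    (g : Fin K → Bool → ℝ) : ℝ :=
  ∑ k, (π k).toReal * ∑ y, (r k y).toReal * g k y

/-- The expectation of a function of the history after `t` slots, when the initial age is fixed. -/
noncomputable def historyExp {K : ℕ} (r : Fin K → PMF Bool) (π : History K → PMF (Fin K)) :
    ℕ → (History K → ℝ) → ℝ
  | 0, g => g []
  | t + 1, g => historyExp r π t fun h => slotExp r (π h) fun k y => g ((k, y) :: h)

lemma PMF.sum_toReal {α : Type*} [Fintype α] (p : PMF α) : ∑ a, (p a).toReal = 1 := by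
  rw [← ENNReal.toReal_sum fun a _ => p.apply_ne_top a, ← tsum_fintype (L := .unconditional _),
    p.tsum_coe, ENNReal.toReal_one]

section SlotExp

variable {K : ℕ} (r : Fin K → PMF Bool) (π : PMF (Fin K))

lemma slotExp_mono {g g' : Fin K → Bool → ℝ} (h : ∀ k y, g k y ≤ g' k y) :
    slotExp r π g ≤ slotExp r π g' := by
  unfold slotExp
  gcongr
  exact h _ _

lemma slotExp_add (g g' : Fin K → Bool → ℝ) :
    slotExp r π (fun k y => g k y + g' k y) = slotExp r π g + slotExp r π g' := by
  simp only [slotExp, mul_add, Finset.sum_add_distrib]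

lemma slotExp_const_mul (c : ℝ) (g : Fin K → Bool → ℝ) :
    slotExp r π (fun k y => c * g k y) = c * slotExp r π g := by
  simp only [slotExp, Finset.mul_sum]
  exact Finset.sum_congr rfl fun _ _ => Finset.sum_congr rfl fun _ _ => by ring

lemma slotExp_arm (f : Fin K → ℝ) :
    slotExp r π (fun k _ => f k) = ∑ k, (π k).toReal * f k := by
  simp only [slotExp, ← Finset.sum_mul, PMF.sum_toReal, one_mul]

lemma slotExp_const (c : ℝ) : slotExp r π (fun _ _ => c) = c := by
  rw [slotExp_arm, ← Finset.sum_mul, PMF.sum_toReal, one_mul]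

lemma slotExp_nonneg {g : Fin K → Bool → ℝ} (h : ∀ k y, 0 ≤ g k y) : 0 ≤ slotExp r π g := by
  have := slotExp_mono r π h
  rwa [slotExp_const] at this

end SlotExp

section HistoryExp

variable {K : ℕ} (r : Fin K → PMF Bool) (π : History K → PMF (Fin K))

lemma historyExp_mono {t : ℕ} {g g' : History K → ℝ} (h : ∀ x, x.length = t → g x ≤ g' x) :
    historyExp r π t g ≤ historyExp r π t g' := by
  induction t generalizing g g' with
  | zero => exact h [] rfl
  | succ t ih =>
    exact ih fun x hx => slotExp_mono _ _ fun k y => h _ (by simp [hx])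

lemma historyExp_add (t : ℕ) (g g' : History K → ℝ) :
    historyExp r π t (fun x => g x + g' x) = historyExp r π t g + historyExp r π t g' := by
  induction t generalizing g g' with
  | zero => rfl
  | succ t ih => simp only [historyExp, slotExp_add, ih]

lemma historyExp_const_mul (t : ℕ) (c : ℝ) (g : History K → ℝ) :
    historyExp r π t (fun x => c * g x) = c * historyExp r π t g := by
  induction t generalizing g with
  | zero => rfl
  | succ t ih => simp only [historyExp, slotExp_const_mul, ih]

lemma historyExp_const (t : ℕ) (c : ℝ) : historyExp r π t (fun _ => c) = c := by
  induction t with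
  | zero => rfl
  | succ t ih => simp only [historyExp, slotExp_const, ih]

lemma historyExp_sum {ι : Type*} (s : Finset ι) (t : ℕ) (g : ι → History K → ℝ) :
    historyExp r π t (fun x => ∑ i ∈ s, g i x) = ∑ i ∈ s, historyExp r π t (g i) := by
  classical
  induction s using Finset.induction_on with
  | empty => simp [historyExp_const]
  | insert a s ha ih => simp only [Finset.sum_insert ha, historyExp_add, ih]

lemma historyExp_le {t : ℕ} {g : History K → ℝ} {c : ℝ} (h : ∀ x, x.length = t → g x ≤ c) :
    historyExp r π t g ≤ c := by
  simpa only [historyExp_const] using historyExp_mono r π (g' := fun _ => c) h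

lemma le_historyExp {t : ℕ} {g : History K → ℝ} {c : ℝ} (h : ∀ x, x.length = t → c ≤ g x) :
    c ≤ historyExp r π t g := by
  simpa only [historyExp_const] using historyExp_mono r π (g := fun _ => c) h

end HistoryExp

section Pulls

variable {K : ℕ}

lemma pulls_cons (i k : Fin K) (y : Bool) (h : History K) :
    pulls i ((k, y) :: h) = pulls i h + if k = i then 1 else 0 := by
  simp [pulls, List.count_cons]

lemma pulls_le_length (k : Fin K) (h : History K) : pulls k h ≤ h.length := by
  simpa [pulls] using List.count_le_length (a := k) (l := h.map Prod.fst)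

lemma sum_pulls (h : History K) : ∑ k, pulls k h = h.length := by
  induction h with
  | nil => simp [pulls]
  | cons x h ih => obtain ⟨k, y⟩ := x; simp [pulls_cons, Finset.sum_add_distrib, ih]

lemma age_le {a : ℕ} (h : History K) : age a h ≤ a + h.length + 1 := by
  induction h with
  | nil => simp [age]
  | cons x h ih =>
    obtain ⟨k, y⟩ := x
    simp only [age, List.length_cons]
    split_ifs <;> omega

lemma one_le_age {a : ℕ} (ha : 1 ≤ a) (h : History K) : 1 ≤ age a h := by
  cases h with
  | nil => exact ha
  | cons x h => obtain ⟨k, y⟩ := x; simp only [age]; split_ifs <;> omega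

end Pulls

/-! ### The law of the trajectory -/

section PMFSums

variable {α β : Type*}

lemma PMF.tsum_bind_mul (p : PMF α) (f : α → PMF β) (g : β → ℝ≥0∞) :
    ∑' b, p.bind f b * g b = ∑' a, p a * ∑' b, f a b * g b := by
  simp only [PMF.bind_apply, ← ENNReal.tsum_mul_right, ← ENNReal.tsum_mul_left]
  rw [ENNReal.tsum_comm]
  simp only [mul_assoc]

lemma PMF.tsum_map_mul (p : PMF α) (f : α → β) (g : β → ℝ≥0∞) :
    ∑' b, p.map f b * g b = ∑' a, p a * g (f a) := by
  classical
  rw [← PMF.bind_pure_comp, PMF.tsum_bind_mul]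
  refine tsum_congr fun a => ?_
  congr 1
  simp [PMF.pure_apply]

end PMFSums

lemma ofReal_slotExp {K : ℕ} (r : Fin K → PMF Bool) (π : PMF (Fin K)) {g : Fin K → Bool → ℝ}
    (hg : ∀ k y, 0 ≤ g k y) :
    ∑' k, π k * ∑' y, r k y * ENNReal.ofReal (g k y) = ENNReal.ofReal (slotExp r π g) := by
  have h (k : Fin K) (y : Bool) : 0 ≤ (r k y).toReal * g k y :=
    mul_nonneg ENNReal.toReal_nonneg (hg k y)
  simp only [slotExp, tsum_fintype]
  rw [ENNReal.ofReal_sum_of_nonneg fun k _ =>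
    mul_nonneg ENNReal.toReal_nonneg (Finset.sum_nonneg fun y _ => h k y)]
  refine Finset.sum_congr rfl fun k _ => ?_
  rw [ENNReal.ofReal_mul ENNReal.toReal_nonneg, ENNReal.ofReal_toReal (π.apply_ne_top k),
    ENNReal.ofReal_sum_of_nonneg fun y _ => h k y]
  congr 1
  refine Finset.sum_congr rfl fun y _ => ?_
  rw [ENNReal.ofReal_mul ENNReal.toReal_nonneg, ENNReal.ofReal_toReal ((r k).apply_ne_top y)]

namespace RewardFunctions

variable {K : ℕ} {S : Type*} [MeasurableSpace S] (B : RewardFunctions K S)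

/-- The law of the reward of arm `k` as a `PMF`. -/
noncomputable def rewardPMF (P : ProbabilityMeasure S) (k : Fin K) : PMF Bool :=
  (B.rewardLaw P k).toPMF

/-- The probability that the initial age is `n + 1`. -/
noncomputable def ageWeight (P : ProbabilityMeasure S) (n : ℕ) : ℝ :=
  (1 - B.bestMean P) ^ n * B.bestMean P

variable {B} {P : ProbabilityMeasure S}

lemma ageWeight_nonneg (n : ℕ) : 0 ≤ B.ageWeight P n :=
  mul_nonneg (pow_nonneg (sub_nonneg.2 (B.bestMean_mem_unitInterval P).2) n)
    (B.bestMean_mem_unitInterval P).1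

/-- Integrating out the newest slot turns the test function for `t + 1` slots into one for `t`
slots, hence the induction over all `g`. Sums in `ℝ≥0∞` need no summability. -/
lemma tsum_trajectory_mul (hpos : 0 < B.bestMean P) (ρ : Policy K) (t : ℕ)
    {g : ℕ × History K → ℝ} (hg : ∀ ω, 0 ≤ g ω) :
    ∑' ω, B.trajectory P ρ t ω * ENNReal.ofReal (g ω) = ∑' n, ENNReal.ofReal (B.ageWeight P n *
      historyExp (B.rewardPMF P) (ρ (n + 1)) t fun h => g (n + 1, h)) := by
  induction t generalizing g with
  | zero =>
    simp only [trajectory, initialAge, PMF.tsum_map_mul, historyExp]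
    refine tsum_congr fun n => ?_
    rw [ENNReal.ofReal_mul (ageWeight_nonneg n), Measure.toPMF_apply, geometricMeasure_singleton]
    · rfl
    · exact fun h => hpos.ne' (congrArg Subtype.val h)
  | succ t ih =>
    simp only [trajectory, PMF.tsum_bind_mul, PMF.tsum_map_mul]
    have h (ω : ℕ × History K) := ofReal_slotExp (B.rewardPMF P) (ρ ω.1 ω.2)
      (g := fun k y => g (ω.1, (k, y) :: ω.2)) fun _ _ => hg _
    simp only [rewardPMF] at h
    simp only [h]
    exact ih fun ω => slotExp_nonneg _ _ fun _ _ => hg _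

lemma pmfExpectation_trajectory (hpos : 0 < B.bestMean P) (ρ : Policy K) (t : ℕ)
    (f : ℕ × History K → ℕ) :
    pmfExpectation (B.trajectory P ρ t) f = ∑' n, B.ageWeight P n *
      historyExp (B.rewardPMF P) (ρ (n + 1)) t fun h => (f (n + 1, h) : ℝ) := by
  have h := tsum_trajectory_mul hpos ρ t (g := fun ω => (f ω : ℝ)) fun _ => Nat.cast_nonneg _
  simp only [ENNReal.ofReal_natCast] at h
  rw [pmfExpectation, h, ENNReal.tsum_toReal_eq fun _ => ENNReal.ofReal_ne_top]
  refine tsum_congr fun n => ENNReal.toReal_ofReal (mul_nonneg (ageWeight_nonneg n) ?_)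
  exact le_historyExp _ _ fun _ _ => Nat.cast_nonneg _

lemma hasSum_ageWeight (hpos : 0 < B.bestMean P) : HasSum (B.ageWeight P) 1 :=
  hasSum_one_geometricMeasure (p := ⟨B.bestMean P, B.bestMean_mem_unitInterval P⟩)
    fun h => hpos.ne' (congrArg Subtype.val h)

lemma hasSum_ageWeight_mul (hpos : 0 < B.bestMean P) :
    HasSum (fun n : ℕ => B.ageWeight P n * (n + 1 : ℝ)) (1 / B.bestMean P) := by
  have h1 := (B.bestMean_mem_unitInterval P).2
  have hn : ‖1 - B.bestMean P‖ < 1 := by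
    rw [Real.norm_eq_abs, abs_lt]; constructor <;> linarith
  have h := (hasSum_coe_mul_geometric_of_norm_lt_one hn).mul_right (B.bestMean P)
  convert! h.add (hasSum_ageWeight hpos) using 1
  · ext n; simp only [ageWeight]; ring
  · rw [sub_sub_cancel]; field_simp [hpos.ne']; ring

lemma hasSum_pulls (hpos : 0 < B.bestMean P) (ρ : Policy K) (k : Fin K) (t : ℕ) :
    HasSum (fun n => B.ageWeight P n *
      historyExp (B.rewardPMF P) (ρ (n + 1)) t fun h => (pulls k h : ℝ))
      (B.expectedPulls P ρ k t) := by
  rw [expectedPulls, pmfExpectation_trajectory hpos]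
  refine Summable.hasSum (Summable.of_nonneg_of_le (fun n => mul_nonneg (ageWeight_nonneg n) ?_)
    (fun n => mul_le_mul_of_nonneg_left ?_ (ageWeight_nonneg n))
    ((hasSum_ageWeight hpos).summable.mul_right (t : ℝ)))
  · exact le_historyExp _ _ fun _ _ => Nat.cast_nonneg _
  · exact historyExp_le _ _ fun x hx => by exact_mod_cast hx ▸ pulls_le_length k x

lemma hasSum_age (hpos : 0 < B.bestMean P) (ρ : Policy K) (t : ℕ) :
    HasSum (fun n => B.ageWeight P n *
      historyExp (B.rewardPMF P) (ρ (n + 1)) t fun h => (age (n + 1) h : ℝ))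
      (B.expectedAge P ρ t) := by
  rw [expectedAge, pmfExpectation_trajectory hpos]
  refine Summable.hasSum (Summable.of_nonneg_of_le (fun n => mul_nonneg (ageWeight_nonneg n) ?_)
    (fun n => ?_) ((hasSum_ageWeight_mul hpos).summable.add
      ((hasSum_ageWeight hpos).summable.mul_right (t + 1 : ℝ))))
  · exact le_historyExp _ _ fun _ _ => Nat.cast_nonneg _
  · rw [← mul_add]
    refine mul_le_mul_of_nonneg_left ?_ (ageWeight_nonneg n)
    refine historyExp_le _ _ fun x hx => ?_
    have := age_le (a := n + 1) x
    rw [hx] at this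
    have : ((age (n + 1) x : ℕ) : ℝ) ≤ ((n + 1 + t + 1 : ℕ) : ℝ) := by exact_mod_cast this
    push_cast at this
    linarith

lemma expectedPulls_nonneg (ρ : Policy K) (k : Fin K) (t : ℕ) : 0 ≤ B.expectedPulls P ρ k t :=
  ENNReal.toReal_nonneg

lemma expectedPulls_zero (hpos : 0 < B.bestMean P) (ρ : Policy K) (k : Fin K) :
    B.expectedPulls P ρ k 0 = 0 := by
  rw [expectedPulls, pmfExpectation_trajectory hpos]
  simp [historyExp, pulls]

lemma sum_expectedPulls (hpos : 0 < B.bestMean P) (ρ : Policy K) (t : ℕ) :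
    ∑ k, B.expectedPulls P ρ k t = t := by
  have h := hasSum_sum fun k (_ : k ∈ Finset.univ) => hasSum_pulls hpos ρ k t
  refine h.unique ?_
  have h1 := (hasSum_ageWeight hpos).mul_right (t : ℝ)
  rw [one_mul] at h1
  refine h1.congr_fun fun n => ?_
  rw [← Finset.mul_sum, ← historyExp_sum]
  congr 1
  have h2 : ∀ x : History K, ∑ k, (pulls k x : ℝ) = x.length := fun x => by
    rw [← sum_pulls x]; push_cast; rfl
  simp only [h2]
  exact le_antisymm (historyExp_le _ _ fun x hx => by rw [hx])
    (le_historyExp _ _ fun x hx => by rw [hx])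

end RewardFunctions

/-! ### The regret in terms of the numbers of pulls -/

namespace RewardFunctions

variable {K : ℕ} {S : Type*} [MeasurableSpace S] {B : RewardFunctions K S}
  {P : ProbabilityMeasure S}

lemma mean_le_bestMean (k : Fin K) : B.mean P k ≤ B.bestMean P :=
  le_ciSup (f := fun k => B.mean P k) (Set.finite_range _).bddAbove k

lemma gap_nonneg (k : Fin K) : 0 ≤ B.gap P k := sub_nonneg.2 (mean_le_bestMean k)

lemma IsOptimalArm.mean_eq {kstar : Fin K} (h : B.IsOptimalArm P kstar) :
    B.mean P kstar = B.bestMean P := by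
  refine (mean_le_bestMean kstar).antisymm ?_
  have : Nonempty (Fin K) := ⟨kstar⟩
  refine ciSup_le fun k => ?_
  rcases eq_or_ne k kstar with rfl | hk
  · exact le_rfl
  · exact (h k hk).le

lemma IsOptimalArm.gap_pos {kstar : Fin K} (h : B.IsOptimalArm P kstar) {k : Fin K}
    (hk : k ≠ kstar) : 0 < B.gap P k := by
  rw [gap, ← h.mean_eq]
  exact sub_pos.2 (h k hk)

lemma mean_eq_real (k : Fin K) : B.mean P k = (B.rewardLaw P k).real {true} := by
  have h : B.mean P k = ∫ y, rewardValue y ∂(B.rewardLaw P k) :=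
    (integral_map (B.measurable_Y k).aemeasurable
      (measurable_of_countable _).aestronglyMeasurable).symm
  rw [h, integral_fintype Integrable.of_finite]
  simp [rewardValue]

lemma rewardPMF_true (k : Fin K) : (B.rewardPMF P k true).toReal = B.mean P k := by
  rw [mean_eq_real]; rfl

lemma rewardPMF_false (k : Fin K) : (B.rewardPMF P k false).toReal = 1 - B.mean P k := by
  have h := (B.rewardPMF P k).sum_toReal
  rw [Fintype.sum_bool, rewardPMF_true] at h
  linarith

/-- Given the history and the arm `k`, the next age has mean `1 + (1 - μ k) * age = 1 + (1 - μ*) *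
age + Δ k * age`, and `age ≥ 1`. The weighted pulls on both sides account for `Δ k` without
subtraction. -/
lemma historyExp_age_succ {a : ℕ} (ha : 1 ≤ a) (π : History K → PMF (Fin K)) (t : ℕ) :
    1 + (1 - B.bestMean P) * historyExp (B.rewardPMF P) π t (fun h => (age a h : ℝ)) +
        historyExp (B.rewardPMF P) π (t + 1) (fun h => ∑ k, B.gap P k * (pulls k h : ℝ)) ≤
      historyExp (B.rewardPMF P) π (t + 1) (fun h => (age a h : ℝ)) +
        historyExp (B.rewardPMF P) π t (fun h => ∑ k, B.gap P k * (pulls k h : ℝ)) := by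
  nth_rewrite 1 [← historyExp_const (B.rewardPMF P) π t 1]
  simp only [historyExp]
  rw [← historyExp_const_mul, ← historyExp_add, ← historyExp_add, ← historyExp_add]
  refine historyExp_mono _ _ fun h _ => ?_
  have hp (k : Fin K) (y : Bool) : ∑ i, B.gap P i * (pulls i ((k, y) :: h) : ℝ) =
      ∑ i, B.gap P i * (pulls i h : ℝ) + B.gap P k := by
    simp [pulls_cons, mul_add, Finset.sum_add_distrib]
  have hage : slotExp (B.rewardPMF P) (π h) (fun k y => (age a ((k, y) :: h) : ℝ)) =
      slotExp (B.rewardPMF P) (π h) fun k _ => 1 + (1 - B.mean P k) * (age a h : ℝ) := by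
    rw [slotExp_arm]
    refine Finset.sum_congr rfl fun k _ => ?_
    rw [Fintype.sum_bool, rewardPMF_true, rewardPMF_false]
    simp only [age, if_true, Bool.false_eq_true, if_false]
    push_cast
    ring
  simp only [hp]
  rw [hage, slotExp_add, slotExp_const]
  have h1 : slotExp (B.rewardPMF P) (π h) (fun k _ => 1 + (1 - B.bestMean P) * (age a h : ℝ) +
      B.gap P k) ≤ slotExp (B.rewardPMF P) (π h) fun k _ => 1 + (1 - B.mean P k) * (age a h : ℝ) :=
    slotExp_mono _ _ fun k y => by
      have h2 : (1 : ℝ) ≤ age a h := by exact_mod_cast one_le_age ha h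
      have := mul_le_mul_of_nonneg_left h2 (gap_nonneg (B := B) (P := P) k)
      simp only [gap] at this ⊢
      linarith
  rw [slotExp_add, slotExp_const] at h1
  linarith

/-- The expected number of pulls, weighted by the gaps. -/
noncomputable def weightedPulls (B : RewardFunctions K S) (P : ProbabilityMeasure S)
    (ρ : Policy K) (t : ℕ) : ℝ :=
  ∑ k, B.gap P k * B.expectedPulls P ρ k t

lemma hasSum_weightedPulls (hpos : 0 < B.bestMean P) (ρ : Policy K) (t : ℕ) :
    HasSum (fun n => B.ageWeight P n * historyExp (B.rewardPMF P) (ρ (n + 1)) t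
      fun h => ∑ k, B.gap P k * (pulls k h : ℝ)) (B.weightedPulls P ρ t) := by
  refine (hasSum_sum fun k (_ : k ∈ Finset.univ) =>
    (hasSum_pulls hpos ρ k t).mul_left (B.gap P k)).congr_fun fun n => ?_
  simp only [historyExp_sum, historyExp_const_mul, Finset.mul_sum]
  exact Finset.sum_congr rfl fun _ _ => by ring

lemma expectedAge_zero (hpos : 0 < B.bestMean P) (ρ : Policy K) :
    B.expectedAge P ρ 0 = 1 / B.bestMean P := by
  refine (hasSum_age hpos ρ 0).unique ?_
  simpa [historyExp, age] using hasSum_ageWeight_mul hpos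

lemma expectedAge_succ (hpos : 0 < B.bestMean P) (ρ : Policy K) (t : ℕ) :
    1 + (1 - B.bestMean P) * B.expectedAge P ρ t + B.weightedPulls P ρ (t + 1) ≤
      B.expectedAge P ρ (t + 1) + B.weightedPulls P ρ t := by
  refine hasSum_le (fun n => ?_) (((hasSum_ageWeight hpos).add
    ((hasSum_age hpos ρ t).mul_left (1 - B.bestMean P))).add (hasSum_weightedPulls hpos ρ (t + 1)))
    ((hasSum_age hpos ρ (t + 1)).add (hasSum_weightedPulls hpos ρ t))
  have := mul_le_mul_of_nonneg_left (historyExp_age_succ (B := B) (P := P) (Nat.le_add_left 1 n)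
    (ρ (n + 1)) t) (ageWeight_nonneg (B := B) (P := P) n)
  linarith

lemma expectedPulls_mono (hpos : 0 < B.bestMean P) (ρ : Policy K) (k : Fin K) (t : ℕ) :
    B.expectedPulls P ρ k t ≤ B.expectedPulls P ρ k (t + 1) := by
  refine hasSum_le (fun n => mul_le_mul_of_nonneg_left ?_ (ageWeight_nonneg n))
    (hasSum_pulls hpos ρ k t) (hasSum_pulls hpos ρ k (t + 1))
  refine historyExp_mono _ _ fun x _ => ?_
  rw [← slotExp_const (B.rewardPMF P) (ρ (n + 1) x) (pulls k x : ℝ)]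
  refine slotExp_mono _ _ fun i y => ?_
  simp only [pulls_cons]
  push_cast
  split_ifs <;> simp

lemma weightedPulls_mono (hpos : 0 < B.bestMean P) (ρ : Policy K) :
    Monotone (B.weightedPulls P ρ) :=
  monotone_nat_of_le_succ fun t => Finset.sum_le_sum fun k _ =>
    mul_le_mul_of_nonneg_left (expectedPulls_mono hpos ρ k t) (gap_nonneg k)

lemma weightedPulls_zero (hpos : 0 < B.bestMean P) (ρ : Policy K) : B.weightedPulls P ρ 0 = 0 := by
  simp [weightedPulls, expectedPulls_zero hpos]

/-- The value `1/μ*` is the fixed point of `x ↦ 1 + (1 - μ*) x`, and the stationary initial age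
starts there. -/
lemma one_div_bestMean_le_expectedAge (hpos : 0 < B.bestMean P) (ρ : Policy K) (t : ℕ) :
    1 / B.bestMean P ≤ B.expectedAge P ρ t := by
  induction t with
  | zero => exact (expectedAge_zero hpos ρ).ge
  | succ t ih =>
    have h1 := expectedAge_succ hpos ρ t
    have h2 := weightedPulls_mono hpos ρ (Nat.le_succ t)
    have h3 := mul_le_mul_of_nonneg_left ih
      (sub_nonneg.2 (B.bestMean_mem_unitInterval P).2)
    have h4 : (1 - B.bestMean P) * (1 / B.bestMean P) = 1 / B.bestMean P - 1 := by field_simp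
    simp only [Nat.succ_eq_add_one] at h2
    linarith

lemma aoiRegret_succ (ρ : Policy K) (T : ℕ) :
    B.aoiRegret P ρ (T + 1) =
      B.aoiRegret P ρ T + (B.expectedAge P ρ T - 1 / B.bestMean P) := by
  simp only [aoiRegret, Finset.sum_range_succ]
  push_cast
  ring

lemma aoiRegret_mono (hpos : 0 < B.bestMean P) (ρ : Policy K) : Monotone (B.aoiRegret P ρ) :=
  monotone_nat_of_le_succ fun T => by
    rw [aoiRegret_succ]
    linarith [one_div_bestMean_le_expectedAge (B := B) (P := P) hpos ρ T]

lemma aoiRegret_zero (ρ : Policy K) : B.aoiRegret P ρ 0 = 0 := by simp [aoiRegret]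

lemma aoiRegret_nonneg (hpos : 0 < B.bestMean P) (ρ : Policy K) (T : ℕ) :
    0 ≤ B.aoiRegret P ρ T :=
  (aoiRegret_zero ρ).symm.le.trans (aoiRegret_mono hpos ρ T.zero_le)

/-- This is `expectedAge_succ` summed over the slots: the drift `-μ*` of the excess age accumulates
to `μ*` times the regret. -/
lemma weightedPulls_le (hpos : 0 < B.bestMean P) (ρ : Policy K) (t : ℕ) :
    B.weightedPulls P ρ t ≤
      B.bestMean P * B.aoiRegret P ρ t + (B.expectedAge P ρ t - 1 / B.bestMean P) := by
  induction t with
  | zero => simp [aoiRegret_zero, expectedAge_zero hpos, weightedPulls_zero hpos]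
  | succ t ih =>
    have h1 := expectedAge_succ hpos ρ t
    rw [aoiRegret_succ]
    have h4 : B.bestMean P * (1 / B.bestMean P) = 1 := by field_simp
    linarith

/-- In the window of slots `m, …, T - 1`, either the expected age stays away from its stationary
value, or the regret is close to the weighted number of pulls. -/
lemma sub_le_aoiRegret_or (hpos : 0 < B.bestMean P) (ρ : Policy K) {m T : ℕ} (hm : m ≤ T) :
    ((T : ℝ) - m ≤ B.aoiRegret P ρ T) ∨
      B.weightedPulls P ρ m - 1 ≤ B.bestMean P * B.aoiRegret P ρ T := by
  induction T, hm using Nat.le_induction with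
  | base => left; simpa using aoiRegret_nonneg hpos ρ m
  | succ T hm ih =>
    have hmono := mul_le_mul_of_nonneg_left (aoiRegret_mono hpos ρ (Nat.le_succ T)) hpos.le
    simp only [Nat.succ_eq_add_one] at hmono
    rcases ih with ih | ih
    · rcases le_total 1 (B.expectedAge P ρ T - 1 / B.bestMean P) with h | h
      · left
        rw [aoiRegret_succ]
        push_cast
        linarith
      · right
        have h1 := weightedPulls_le hpos ρ T
        have h2 := weightedPulls_mono hpos ρ hm
        linarith
    · right
      linarith

lemma log_le_aoiRegret (hpos : 0 < B.bestMean P) (ρ : Policy K) {c β C : ℝ} (hc : 0 ≤ c)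
    (hβ : 0 ≤ β)
    (h : ∀ t : ℕ, 1 ≤ t → c * (β * Real.log t - C) ≤ B.weightedPulls P ρ t) :
    ∃ C' : ℝ, ∀ T : ℕ, 1 ≤ T →
      c * (β * Real.log T - C') ≤ B.bestMean P * B.aoiRegret P ρ T := by
  have hR (T : ℕ) : 0 ≤ B.bestMean P * B.aoiRegret P ρ T :=
    mul_nonneg hpos.le (aoiRegret_nonneg hpos ρ T)
  rcases hc.eq_or_lt with rfl | hc
  · exact ⟨0, fun T _ => by simpa using hR T⟩
  rcases hβ.eq_or_lt with rfl | hβ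
  · exact ⟨0, fun T _ => by simpa using hR T⟩
  -- The scale at which the linear bound `μ* T / 2` equals `c * β * (T * s)`; then `log (T * s) ≤ T
  -- * s - 1` compares it with the logarithm.
  set s : ℝ := B.bestMean P / (2 * (c * β)) with hs
  have hs0 : 0 < s := by positivity
  -- `C₁` pays for passing from `T` to `T / 2` (as `T ≤ 4 * (T / 2)` for `T ≥ 2`) and for the lost
  -- `1`; `C₂` serves the linear case, and the `0` in the maximum serves `T = 1`.
  set C₁ : ℝ := C + β * Real.log 4 + 1 / c
  set C₂ : ℝ := -β * (1 + Real.log s)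
  refine ⟨max 0 (max C₁ C₂), fun T hT => ?_⟩
  rcases hT.eq_or_lt with rfl | hT2
  · refine le_trans (mul_nonpos_of_nonneg_of_nonpos hc.le ?_) (hR 1)
    simp
  have hT0 : (0 : ℝ) < T := by positivity
  rcases sub_le_aoiRegret_or hpos ρ (Nat.div_le_self T 2) with h1 | h1
  · have h2 : ((T / 2 : ℕ) : ℝ) ≤ T / 2 := Nat.cast_div_le
    have h3 : B.bestMean P * (T / 2) ≤ B.bestMean P * B.aoiRegret P ρ T :=
      mul_le_mul_of_nonneg_left (by linarith) hpos.le
    have h4 := Real.log_le_sub_one_of_pos (mul_pos hT0 hs0)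
    rw [Real.log_mul hT0.ne' hs0.ne'] at h4
    have h5 : β * Real.log T ≤ β * (T * s) + C₂ := by
      have := mul_le_mul_of_nonneg_left h4 hβ.le
      simp only [C₂]
      linarith
    have h6 : c * (β * (T * s)) = B.bestMean P * (T / 2) := by rw [hs]; field_simp
    refine le_trans (mul_le_mul_of_nonneg_left ?_ hc.le) (h6.le.trans h3)
    linarith [le_max_right C₁ C₂, le_max_right 0 (max C₁ C₂)]
  · have hm : 1 ≤ T / 2 := by omega
    have h2 := h _ hm
    have h3 : Real.log T ≤ Real.log (T / 2 : ℕ) + Real.log 4 := by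
      rw [← Real.log_mul (by positivity) (by norm_num)]
      refine Real.log_le_log hT0 ?_
      have : T ≤ T / 2 * 4 := by omega
      exact_mod_cast this
    have h4 : c * (β * Real.log T - C₁) ≤ c * (β * Real.log (T / 2 : ℕ) - C) - 1 := by
      have := mul_le_mul_of_nonneg_left (mul_le_mul_of_nonneg_left h3 hβ.le) hc.le
      have h5 : c * (1 / c) = 1 := by field_simp
      simp only [C₁]
      linarith
    have h6 : c * (β * Real.log T - max 0 (max C₁ C₂)) ≤ c * (β * Real.log T - C₁) := by
      gcongr
      exact (le_max_left _ _).trans (le_max_right _ _)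
    linarith

end RewardFunctions

/-! ### Change of measure -/

/-- The exponential lies above its tangents. -/
lemma exp_mul_one_add_sub_le (m x : ℝ) : Real.exp m * (1 + x - m) ≤ Real.exp x := by
  have h := Real.add_one_le_exp (x - m)
  calc Real.exp m * (1 + x - m) ≤ Real.exp m * Real.exp (x - m) := by gcongr; linarith
    _ = Real.exp x := by rw [← Real.exp_add]; ring_nf

/-- The Donsker-Varadhan inequality on a finite type. -/
lemma exp_sum_sub_klDiv_le {α : Type*} [Fintype α] [MeasurableSpace α] [MeasurableSingletonClass α]
    (μ ν : Measure α) [IsProbabilityMeasure μ] [IsProbabilityMeasure ν]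
    (h : InformationTheory.klDiv μ ν ≠ ∞) (g : α → ℝ) :
    Real.exp (∑ y, μ.real {y} * g y - (InformationTheory.klDiv μ ν).toReal) ≤
      ∑ y, ν.real {y} * Real.exp (g y) := by
  have hac := (InformationTheory.klDiv_ne_top_iff.1 h).1
  have hkl : (InformationTheory.klDiv μ ν).toReal = ∑ y, μ.real {y} * llr μ ν y := by
    rw [InformationTheory.toReal_klDiv_of_measure_eq hac (by simp),
      integral_fintype Integrable.of_finite]
    rfl
  have hd (y : α) : μ.real {y} = (μ.rnDeriv ν y).toReal * ν.real {y} := by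
    rw [measureReal_def, ← Measure.setLIntegral_rnDeriv hac {y}, lintegral_singleton,
      ENNReal.toReal_mul, measureReal_def]
  set m := ∑ y, μ.real {y} * g y - (InformationTheory.klDiv μ ν).toReal with hm
  have hone : ∑ y, μ.real {y} = 1 := by simp
  -- Jensen by the tangent of `exp` at `m`: the `μ`-mean of `g - llr` is `m`, so the linear term
  -- averages to `1`.
  calc Real.exp m = Real.exp m * (∑ y, μ.real {y} * (1 + (g y - llr μ ν y) - m)) := by
        have : ∑ y, μ.real {y} * (1 + (g y - llr μ ν y) - m) = ∑ y, μ.real {y} +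
            (∑ y, μ.real {y} * g y - ∑ y, μ.real {y} * llr μ ν y) - (∑ y, μ.real {y}) * m := by
          rw [Finset.sum_mul, ← Finset.sum_sub_distrib, ← Finset.sum_add_distrib,
            ← Finset.sum_sub_distrib]
          exact Finset.sum_congr rfl fun _ _ => by ring
        rw [this, hone, ← hkl, ← hm]
        ring
    _ ≤ ∑ y, ν.real {y} * Real.exp (g y) := by
        rw [Finset.mul_sum]
        refine Finset.sum_le_sum fun y _ => ?_
        rcases (measureReal_nonneg (μ := μ) (s := {y})).eq_or_lt with h0 | h0
        · rw [← h0]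
          simp only [zero_mul, mul_zero]
          positivity
        · have hr : 0 < (μ.rnDeriv ν y).toReal := by
            refine ENNReal.toReal_nonneg.lt_of_ne fun hr => ?_
            rw [hd, ← hr, zero_mul] at h0
            exact h0.ne rfl
          have hx : ν.real {y} * Real.exp (g y) = μ.real {y} * Real.exp (g y - llr μ ν y) := by
            rw [hd, Real.exp_sub, llr, Real.exp_log hr]
            field_simp
          rw [hx, mul_left_comm]
          exact mul_le_mul_of_nonneg_left (exp_mul_one_add_sub_le _ _) h0.le

lemma exp_slotExp_le {K : ℕ} {r r' : Fin K → PMF Bool} {D : Fin K → ℝ} (π : PMF (Fin K))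
    (hD : ∀ k (g : Bool → ℝ), Real.exp (∑ y, (r k y).toReal * g y - D k) ≤
      ∑ y, (r' k y).toReal * Real.exp (g y)) (g : Fin K → Bool → ℝ) :
    Real.exp (slotExp r π fun k y => g k y - D k) ≤
      slotExp r' π fun k y => Real.exp (g k y) := by
  have h1 : (slotExp r π fun k y => g k y - D k) =
      ∑ k, (π k).toReal • (∑ y, (r k y).toReal * g k y - D k) := by
    refine Finset.sum_congr rfl fun k _ => ?_
    simp only [smul_eq_mul, mul_sub, Finset.sum_sub_distrib, ← Finset.sum_mul, PMF.sum_toReal,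
      one_mul]
  rw [h1]
  refine (convexOn_exp.map_sum_le (fun k _ => ENNReal.toReal_nonneg) π.sum_toReal
    fun k _ => Set.mem_univ _).trans ?_
  exact Finset.sum_le_sum fun k _ => mul_le_mul_of_nonneg_left (hD k _) ENNReal.toReal_nonneg

/-- The chain rule for divergence in Donsker-Varadhan form: each slot costs `D k` for the arm
pulled, by Jensen over the arm and `hD` for its reward. The policy is the same on both sides and
costs nothing. -/
lemma exp_historyExp_le {K : ℕ} {r r' : Fin K → PMF Bool} {D : Fin K → ℝ}
    (π : History K → PMF (Fin K))
    (hD : ∀ k (g : Bool → ℝ), Real.exp (∑ y, (r k y).toReal * g y - D k) ≤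
      ∑ y, (r' k y).toReal * Real.exp (g y)) (t : ℕ) (g : History K → ℝ) :
    Real.exp (historyExp r π t fun h => g h - ∑ k, D k * (pulls k h : ℝ)) ≤
      historyExp r' π t fun h => Real.exp (g h) := by
  induction t generalizing g with
  | zero => simp [historyExp, pulls]
  | succ t ih =>
    refine le_trans (le_of_eq ?_) ((ih fun h => slotExp r (π h) fun k y =>
      g ((k, y) :: h) - D k).trans (historyExp_mono _ _ fun h _ => exp_slotExp_le (π h) hD _))
    simp only [historyExp]
    congr 2
    ext h
    have hp (k : Fin K) (y : Bool) : g ((k, y) :: h) - ∑ i, D i * (pulls i ((k, y) :: h) : ℝ) =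
        g ((k, y) :: h) - D k + -∑ i, D i * (pulls i h : ℝ) := by
      simp [pulls_cons, mul_add, Finset.sum_add_distrib]
      ring
    simp only [hp]
    rw [slotExp_add, slotExp_const, sub_eq_add_neg]

namespace RewardFunctions

variable {K : ℕ} {S : Type*} [MeasurableSpace S] {B : RewardFunctions K S}
  {P Q : ProbabilityMeasure S}

/-- Changing the law of the initial age costs a constant. -/
lemma exists_exp_tsum_ageWeight_le (hP0 : 0 < B.bestMean P) (hP1 : B.bestMean P < 1)
    (hQ0 : 0 < B.bestMean Q) (hQ1 : B.bestMean Q < 1) :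
    ∃ C : ℝ, ∀ (F H : ℕ → ℝ) (x y : ℝ), (∀ n, Real.exp (F n) ≤ H n) →
      HasSum (fun n => B.ageWeight P n * F n) x → HasSum (fun n => B.ageWeight Q n * H n) y →
      Real.exp (x - C) ≤ y := by
  set p := B.bestMean P
  set q := B.bestMean Q
  -- The log-likelihood ratio of the two geometric laws; it is affine in the age, so its mean `ℓ`
  -- exists, and `-ℓ` is their divergence.
  set L : ℕ → ℝ := fun n => (n + 1) * Real.log ((1 - q) / (1 - p)) +
    (Real.log (q / p) - Real.log ((1 - q) / (1 - p))) with hL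
  have hp' : 0 < 1 - p := sub_pos.2 hP1
  have hq' : 0 < 1 - q := sub_pos.2 hQ1
  have hw (n : ℕ) : B.ageWeight Q n = B.ageWeight P n * Real.exp (L n) := by
    have : L n = Real.log (((1 - q) / (1 - p)) ^ n * (q / p)) := by
      rw [Real.log_mul (by positivity) (by positivity), Real.log_pow, hL]
      ring
    rw [this, Real.exp_log (by positivity)]
    change (1 - q) ^ n * q = (1 - p) ^ n * p * _
    rw [div_pow]
    field_simp
  obtain ⟨ℓ, hℓ⟩ : ∃ ℓ, HasSum (fun n => B.ageWeight P n * L n) ℓ := by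
    refine ⟨_, (((hasSum_ageWeight_mul hP0).mul_right (Real.log ((1 - q) / (1 - p)))).add
      ((hasSum_ageWeight hP0).mul_right
        (Real.log (q / p) - Real.log ((1 - q) / (1 - p))))).congr_fun fun n => ?_⟩
    rw [hL]
    ring
  refine ⟨-ℓ, fun F H x y hFH hx hy => ?_⟩
  rw [sub_neg_eq_add]
  -- The tangent of `exp` at the mean `x + ℓ`, summed against the age weights.
  have h1 := (((hasSum_ageWeight hP0).add (hx.add hℓ)).sub
    ((hasSum_ageWeight hP0).mul_right (x + ℓ))).mul_left (Real.exp (x + ℓ))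
  have h2 : Real.exp (x + ℓ) * (1 + (x + ℓ) - 1 * (x + ℓ)) = Real.exp (x + ℓ) := by ring
  rw [h2] at h1
  refine hasSum_le (fun n => ?_) h1 hy
  calc _ = B.ageWeight P n * (Real.exp (x + ℓ) * (1 + (F n + L n) - (x + ℓ))) := by ring
    _ ≤ B.ageWeight P n * Real.exp (F n + L n) :=
        mul_le_mul_of_nonneg_left (exp_mul_one_add_sub_le _ _) (ageWeight_nonneg n)
    _ = B.ageWeight Q n * Real.exp (F n) := by rw [hw, Real.exp_add]; ring
    _ ≤ _ := mul_le_mul_of_nonneg_left (hFH n) (ageWeight_nonneg n)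

lemma exp_sum_rewardPMF_le {k : Fin K} (h : B.rewardDiv P Q k ≠ ∞) (g : Bool → ℝ) :
    Real.exp (∑ y, (B.rewardPMF P k y).toReal * g y - (B.rewardDiv P Q k).toReal) ≤
      ∑ y, (B.rewardPMF Q k y).toReal * Real.exp (g y) :=
  exp_sum_sub_klDiv_le (B.rewardLaw P k) (B.rewardLaw Q k) h g

/-- The change of measure is applied to `l * N / t`, where the fraction `N / t` of pulls lies in
`[0, 1]`; the chord of `exp` over `[0, l]` makes the right side linear in `N`. -/
lemma exists_exp_expectedPulls_le (hP0 : 0 < B.bestMean P) (hP1 : B.bestMean P < 1)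
    (hQ0 : 0 < B.bestMean Q) (hQ1 : B.bestMean Q < 1) (hD : ∀ k, B.rewardDiv P Q k ≠ ∞) :
    ∃ C : ℝ, ∀ (ρ : Policy K) (i : Fin K) (t : ℕ) (l : ℝ), 1 ≤ t →
      Real.exp (l / t * B.expectedPulls P ρ i t -
        ∑ k, (B.rewardDiv P Q k).toReal * B.expectedPulls P ρ k t - C) ≤
      1 + (Real.exp l - 1) / t * B.expectedPulls Q ρ i t := by
  obtain ⟨C, hC⟩ := exists_exp_tsum_ageWeight_le hP0 hP1 hQ0 hQ1
  refine ⟨C, fun ρ i t l ht => ?_⟩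
  have ht0 : (0 : ℝ) < t := by positivity
  refine hC
    (fun n => historyExp (B.rewardPMF P) (ρ (n + 1)) t
      fun h => l / t * (pulls i h : ℝ) - ∑ k, (B.rewardDiv P Q k).toReal * (pulls k h : ℝ))
    (fun n => historyExp (B.rewardPMF Q) (ρ (n + 1)) t
      fun h => 1 + (Real.exp l - 1) / t * (pulls i h : ℝ)) _ _ (fun n => ?_) ?_ ?_
  · refine (exp_historyExp_le _ (fun k => exp_sum_rewardPMF_le (hD k)) t _).trans
      (historyExp_mono _ _ fun h hh => ?_)
    have h1 : (pulls i h : ℝ) / t ≤ 1 := by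
      rw [div_le_one ht0]
      exact_mod_cast hh ▸ pulls_le_length i h
    have h2 : 0 ≤ (pulls i h : ℝ) / t := by positivity
    have h3 := convexOn_exp.2 (Set.mem_univ 0) (Set.mem_univ l) (sub_nonneg.2 h1) h2 (by ring)
    simp only [smul_eq_mul, mul_zero, zero_add, Real.exp_zero, mul_one] at h3
    calc _ = Real.exp ((pulls i h : ℝ) / t * l) := by ring_nf
      _ ≤ _ := h3
      _ = _ := by ring
  · refine (((hasSum_pulls hP0 ρ i t).mul_left (l / t)).sub
      (hasSum_sum fun k (_ : k ∈ Finset.univ) =>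
        (hasSum_pulls hP0 ρ k t).mul_left (B.rewardDiv P Q k).toReal)).congr_fun fun n => ?_
    simp only [sub_eq_add_neg, ← neg_one_mul (∑ k, _)]
    rw [historyExp_add, historyExp_const_mul, historyExp_const_mul, historyExp_sum]
    simp only [historyExp_const_mul, mul_add, Finset.mul_sum, neg_one_mul]
    congr 1
    · ring
    · exact Finset.sum_congr rfl fun _ _ => by ring
  · refine ((hasSum_ageWeight hQ0).add
      ((hasSum_pulls hQ0 ρ i t).mul_left ((Real.exp l - 1) / t))).congr_fun fun n => ?_
    rw [historyExp_add, historyExp_const, historyExp_const_mul]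
    ring

/-- If `kstar` is optimal under `P` but not under `Q`, then a consistent policy has to collect
logarithmically much information that distinguishes `P` from `Q`. -/
lemma log_le_sum_rewardDiv_mul_expectedPulls {kstar : Fin K} (hopt : B.IsOptimalArm P kstar)
    (hP0 : 0 < B.bestMean P) (hP1 : B.bestMean P < 1) (hQ1 : B.bestMean Q < 1)
    (hkstar : 0 < B.gap Q kstar) (hD : ∀ k, B.rewardDiv P Q k ≠ ∞) {ρ : Policy K} {α : ℝ}
    (hρ : B.IsConsistent ρ α) :
    ∃ C : ℝ, ∀ t : ℕ, 1 ≤ t → (1 - α) * Real.log t - C ≤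
      ∑ k, (B.rewardDiv P Q k).toReal * B.expectedPulls P ρ k t := by
  have hQ0 : 0 < B.bestMean Q := by
    have := (B.mean_mem_Icc Q kstar).1
    simp only [gap] at hkstar
    linarith
  obtain ⟨C₀, hC₀⟩ := exists_exp_expectedPulls_le hP0 hP1 hQ0 hQ1 hD
  obtain ⟨MP, hMP⟩ := hρ.2.2 P
  obtain ⟨MQ, hMQ⟩ := hρ.2.2 Q
  set M : ℝ := max 1 (max MP MQ) with hM
  have hM1 : 1 ≤ M := le_max_left _ _
  have hMP' : MP ≤ M := (le_max_left _ _).trans (le_max_right _ _)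
  have hMQ' : MQ ≤ M := (le_max_right _ _).trans (le_max_right _ _)
  have hK : (1 : ℝ) ≤ K := by
    have : 1 ≤ K := kstar.pos
    exact_mod_cast this
  refine ⟨Real.log (K * M) + 1 + Real.log 2 + |C₀|, fun t ht => ?_⟩
  have ht0 : (0 : ℝ) < t := by positivity
  have hta : (0 : ℝ) < (t : ℝ) ^ α := Real.rpow_pos_of_pos ht0 α
  -- Bounds both the fraction of pulls of arms other than `kstar` under `P` (the factor `K` sums
  -- over arms) and the fraction of pulls of `kstar` under `Q`. The choice `l = -log ε` below
  -- balances them.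
  set ε : ℝ := K * M * (t : ℝ) ^ α / t with hε
  have hε0 : 0 < ε := by positivity
  have hlog : -Real.log ε = (1 - α) * Real.log t - Real.log (K * M) := by
    rw [hε, Real.log_div (by positivity) ht0.ne', Real.log_mul (by positivity) hta.ne',
      Real.log_rpow ht0]
    ring
  have hinfo : 0 ≤ ∑ k, (B.rewardDiv P Q k).toReal * B.expectedPulls P ρ k t :=
    Finset.sum_nonneg fun k _ => mul_nonneg ENNReal.toReal_nonneg (expectedPulls_nonneg ρ k t)
  have h2 : 0 < Real.log 2 := Real.log_pos one_lt_two
  rcases le_total 1 ε with h1 | h1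
  · have := Real.log_nonneg h1
    linarith [abs_nonneg C₀]
  have hl : 0 ≤ -Real.log ε := neg_nonneg.2 (Real.log_nonpos hε0.le h1)
  have hP : (t : ℝ) - K * M * (t : ℝ) ^ α ≤ B.expectedPulls P ρ kstar t := by
    have hs := sum_expectedPulls (B := B) hP0 ρ t
    rw [← Finset.add_sum_erase _ _ (Finset.mem_univ kstar)] at hs
    have : ∑ k ∈ Finset.univ.erase kstar, B.expectedPulls P ρ k t ≤
        ∑ _k : Fin K, M * (t : ℝ) ^ α :=
      (Finset.sum_le_sum fun k hk => (hMP k (hopt.gap_pos (Finset.ne_of_mem_erase hk)) t).trans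
        (mul_le_mul_of_nonneg_right hMP' hta.le)).trans
        (Finset.sum_le_sum_of_subset_of_nonneg (Finset.erase_subset _ _) fun _ _ _ => by positivity)
    rw [Finset.sum_const, Finset.card_univ, Fintype.card_fin, nsmul_eq_mul] at this
    linarith
  have hQ : B.expectedPulls Q ρ kstar t ≤ K * M * (t : ℝ) ^ α := by
    refine (hMQ kstar hkstar t).trans (mul_le_mul_of_nonneg_right ?_ hta.le)
    nlinarith
  have hexp : Real.exp (-Real.log ε) = 1 / ε := by rw [Real.exp_neg, Real.exp_log hε0, one_div]
  have hmain := hC₀ ρ kstar t (-Real.log ε) ht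
  have hright : 1 + (Real.exp (-Real.log ε) - 1) / t * B.expectedPulls Q ρ kstar t ≤ 2 := by
    have h3 : B.expectedPulls Q ρ kstar t / t ≤ ε := by rw [hε]; gcongr
    have h4 : 0 ≤ B.expectedPulls Q ρ kstar t / t :=
      div_nonneg (expectedPulls_nonneg ρ kstar t) ht0.le
    have h5 : 1 / ε * (B.expectedPulls Q ρ kstar t / t) ≤ 1 / ε * ε := by gcongr
    rw [one_div_mul_cancel hε0.ne'] at h5
    rw [hexp]
    calc _ = 1 + (1 / ε * (B.expectedPulls Q ρ kstar t / t) -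
          B.expectedPulls Q ρ kstar t / t) := by ring
      _ ≤ 2 := by linarith
  have hlow := (Real.le_log_iff_exp_le two_pos).2 (hmain.trans hright)
  have h6 : -Real.log ε * (1 - ε) ≤ -Real.log ε / t * B.expectedPulls P ρ kstar t := by
    have : 1 - ε ≤ B.expectedPulls P ρ kstar t / t := by
      rw [hε, le_div_iff₀ ht0, sub_mul, div_mul_cancel₀ _ ht0.ne']
      linarith
    calc _ ≤ -Real.log ε * (B.expectedPulls P ρ kstar t / t) := by gcongr
      _ = _ := by ring
  -- Replacing `1 - ε` by `1` in `h6` costs at most `1`, by `log x ≤ x - 1` at `x = 1 / ε`.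
  have h7 : -Real.log ε * ε ≤ 1 := by
    have h8 := Real.log_le_sub_one_of_pos (inv_pos.2 hε0)
    rw [Real.log_inv] at h8
    have h9 := mul_le_mul_of_nonneg_right h8 hε0.le
    rw [sub_mul, inv_mul_cancel₀ hε0.ne'] at h9
    linarith
  have := le_abs_self C₀
  have := neg_abs_le C₀
  linarith

/-- The lower bound on the regret which is implied by the information needed to distinguish `P`
from `Q`, when each pull of an arm `k` costs at least `c` times the information it yields. -/
lemma exists_log_le_aoiRegret {kstar : Fin K} (hopt : B.IsOptimalArm P kstar)
    (hP0 : 0 < B.bestMean P) (hP1 : B.bestMean P < 1) (hQ1 : B.bestMean Q < 1)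
    (hkstar : 0 < B.gap Q kstar) (hD : ∀ k, B.rewardDiv P Q k ≠ ∞) {c : ℝ} (hc : 0 ≤ c)
    (hcD : ∀ k, c * (B.rewardDiv P Q k).toReal ≤ B.gap P k) {ρ : Policy K} {α : ℝ}
    (hρ : B.IsConsistent ρ α) :
    ∃ C : ℝ, ∀ T : ℕ, 1 ≤ T → c * ((1 - α) * Real.log T - C) ≤
      B.bestMean P * B.aoiRegret P ρ T := by
  obtain ⟨C, hC⟩ := log_le_sum_rewardDiv_mul_expectedPulls hopt hP0 hP1 hQ1 hkstar hD hρ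
  refine log_le_aoiRegret hP0 ρ hc (sub_nonneg.2 hρ.2.1.le) (C := C) fun t ht => ?_
  refine (mul_le_mul_of_nonneg_left (hC t ht) hc).trans ?_
  rw [Finset.mul_sum]
  refine Finset.sum_le_sum fun k _ => ?_
  rw [← mul_assoc]
  exact mul_le_mul_of_nonneg_right (hcD k) (expectedPulls_nonneg ρ k t)

end RewardFunctions

/-! ### Perturbations -/

namespace MeasureTheory.ProbabilityMeasure

variable {S : Type*} [MeasurableSpace S]

/-- The mixture which has weight `δ` on `P` and weight `1 - δ` on `R`. -/
noncomputable def mixture (P R : ProbabilityMeasure S) (δ : unitInterval) : ProbabilityMeasure S :=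
  ⟨ENNReal.ofReal δ • (P : Measure S) + ENNReal.ofReal (1 - δ) • (R : Measure S), ⟨by
    simp only [Measure.coe_add, Measure.coe_smul, Pi.add_apply, Pi.smul_apply, measure_univ,
      smul_eq_mul, mul_one]
    rw [← ENNReal.ofReal_add δ.2.1 (sub_nonneg.2 δ.2.2), add_sub_cancel, ENNReal.ofReal_one]⟩⟩

end MeasureTheory.ProbabilityMeasure

namespace RewardFunctions

variable {K : ℕ} {S : Type*} [MeasurableSpace S] {B : RewardFunctions K S}
  {P R : ProbabilityMeasure S} {δ : unitInterval}

lemma rewardLaw_mixture (k : Fin K) : B.rewardLaw (P.mixture R δ) k =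
    ENNReal.ofReal δ • B.rewardLaw P k + ENNReal.ofReal (1 - δ) • B.rewardLaw R k := by
  simp only [rewardLaw, ProbabilityMeasure.mixture, ProbabilityMeasure.coe_mk]
  rw [Measure.map_add _ _ (B.measurable_Y k), Measure.map_smul, Measure.map_smul]

lemma mean_mixture (k : Fin K) :
    B.mean (P.mixture R δ) k = δ * B.mean P k + (1 - δ) * B.mean R k := by
  have h (P' : ProbabilityMeasure S) (a : ℝ≥0∞) (ha : a ≠ ∞) :
      (a • B.rewardLaw P' k) {true} ≠ ∞ := ENNReal.mul_ne_top ha (measure_ne_top _ _)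
  simp only [mean_eq_real, rewardLaw_mixture]
  rw [measureReal_add_apply (h P _ ENNReal.ofReal_ne_top) (h R _ ENNReal.ofReal_ne_top),
    measureReal_ennreal_smul_apply,
    measureReal_ennreal_smul_apply, ENNReal.toReal_ofReal δ.2.1,
    ENNReal.toReal_ofReal (sub_nonneg.2 δ.2.2)]

lemma rewardDiv_ne_top_of_ac {Q : ProbabilityMeasure S} {k : Fin K}
    (h : B.rewardLaw P k ≪ B.rewardLaw Q k) : B.rewardDiv P Q k ≠ ∞ :=
  InformationTheory.klDiv_ne_top h Integrable.of_finite

/-- The positive weight on `P` makes its reward laws absolutely continuous with respect to those of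
the mixture. -/
lemma rewardDiv_mixture_ne_top (hδ : 0 < (δ : ℝ)) (k : Fin K) :
    B.rewardDiv P (P.mixture R δ) k ≠ ∞ := by
  refine rewardDiv_ne_top_of_ac (Measure.AbsolutelyContinuous.mk fun s _ hs => ?_)
  rw [rewardLaw_mixture] at hs
  simp only [Measure.coe_add, Measure.coe_smul, Pi.add_apply, Pi.smul_apply, smul_eq_mul,
    add_eq_zero, mul_eq_zero, ENNReal.ofReal_eq_zero, not_le.2 hδ, false_or] at hs
  exact hs.1

lemma bestMean_lt_of_forall [Nonempty (Fin K)] {c : ℝ} (h : ∀ k, B.mean P k < c) :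
    B.bestMean P < c := by
  obtain ⟨k, hk⟩ := exists_eq_ciSup_of_finite (f := fun k => B.mean P k)
  exact hk.symm.trans_lt (h k)

lemma isPerturbation_mixture {kstar k : Fin K} (hδ : 0 < (δ : ℝ))
    (hkstar : B.mean R kstar ≤ B.bestMean P) (hk : (δ : ℝ) < B.mean R k - B.bestMean P) :
    B.IsPerturbation P kstar k (P.mixture R δ) := by
  have h1 : B.bestMean P < B.mean (P.mixture R δ) k := by
    rw [mean_mixture]
    nlinarith [(B.mean_mem_Icc P k).1, (B.mean_mem_Icc R k).2]
  refine ⟨h1, lt_of_le_of_lt ?_ h1, rewardDiv_mixture_ne_top hδ k⟩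
  rw [mean_mixture]
  nlinarith [δ.2.2, mean_le_bestMean (B := B) (P := P) kstar]

/-- Donsker-Varadhan with the test function that is `l` on failure and `0` on success; its
exponential has `Q`-mean at most `2`. -/
lemma le_rewardDiv {Q : ProbabilityMeasure S} {k : Fin K} (h : B.rewardDiv P Q k ≠ ∞) {l : ℝ}
    (hl : 1 - B.mean Q k ≤ Real.exp (-l)) :
    (1 - B.mean P k) * l - Real.log 2 ≤ (B.rewardDiv P Q k).toReal := by
  have h1 := exp_sum_rewardPMF_le h fun y => if y then 0 else l
  simp only [Fintype.sum_bool, rewardPMF_true, rewardPMF_false, if_true, Bool.false_eq_true,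
    if_false, Real.exp_zero] at h1
  have h2 : (1 - B.mean Q k) * Real.exp l ≤ 1 := by
    refine (mul_le_mul_of_nonneg_right hl (Real.exp_pos l).le).trans ?_
    rw [← Real.exp_add, neg_add_cancel, Real.exp_zero]
  have h3 := (Real.le_log_iff_exp_le two_pos).2
    (h1.trans (by linarith [(B.mean_mem_Icc Q k).2] : _ ≤ (2 : ℝ)))
  linarith

lemma rewardValue_nonneg (b : Bool) : 0 ≤ rewardValue b := by cases b <;> simp [rewardValue]

lemma rewardValue_le_one (b : Bool) : rewardValue b ≤ 1 := by cases b <;> simp [rewardValue]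

lemma pseudoReward_le_one (l k : Fin K) (r : Bool) : B.pseudoReward l k r ≤ 1 :=
  Real.iSup_le (fun _ => rewardValue_le_one _) zero_le_one

lemma pseudoReward_eq_zero {l k : Fin K} {r : Bool} (h : ∀ x, B.Y k x = r → B.Y l x = false) :
    B.pseudoReward l k r = 0 := by
  have h1 (x : {x : S // B.Y k x = r}) : rewardValue (B.Y l x) = 0 := by
    rw [h x x.2]; simp [rewardValue]
  simp [pseudoReward, h1]

lemma expectedPseudoReward_eq (l k : Fin K) : B.expectedPseudoReward P l k =
    B.mean P k * B.pseudoReward l k true + (1 - B.mean P k) * B.pseudoReward l k false := by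
  have h : B.expectedPseudoReward P l k = ∫ y, B.pseudoReward l k y ∂(B.rewardLaw P k) :=
    (integral_map (B.measurable_Y k).aemeasurable
      (measurable_of_countable _).aestronglyMeasurable).symm
  rw [h, integral_fintype Integrable.of_finite, Fintype.sum_bool, ← rewardPMF_false,
    ← rewardPMF_true]
  rfl

/-! ### Perturbations in favour of strictly competitive arms -/

section Competitive

variable {kstar k : Fin K}

/-- Otherwise a failure of `kstar` would force a failure of `k`, and the expected pseudo reward
would be at most `μ*`. -/
lemma exists_state_of_pseudoGap_neg (hopt : B.IsOptimalArm P kstar)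
    (hgap : B.pseudoGap P k kstar < 0) :
    ∃ x, B.Y k x = true ∧ B.Y kstar x = false := by
  by_contra! h
  rw [pseudoGap, expectedPseudoReward_eq, hopt.mean_eq,
    pseudoReward_eq_zero (r := false) fun x hx => by
      by_contra hk
      exact h x (by simpa using hk) hx] at hgap
  have := mul_le_mul_of_nonneg_left (B.pseudoReward_le_one k kstar true)
    (B.bestMean_mem_unitInterval P).1
  linarith

lemma bestMean_lt_one_of_pseudoGap_neg (hopt : B.IsOptimalArm P kstar)
    (hgap : B.pseudoGap P k kstar < 0) :
    B.bestMean P < 1 := by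
  rw [pseudoGap, expectedPseudoReward_eq, hopt.mean_eq] at hgap
  have h1 := mul_le_mul_of_nonneg_left (B.pseudoReward_le_one k kstar true)
    (B.bestMean_mem_unitInterval P).1
  have h2 := mul_le_mul_of_nonneg_left (B.pseudoReward_le_one k kstar false)
    (sub_nonneg.2 (B.bestMean_mem_unitInterval P).2)
  linarith

lemma ne_of_pseudoGap_neg (hopt : B.IsOptimalArm P kstar)
    (hgap : B.pseudoGap P k kstar < 0) :
    k ≠ kstar := by
  rintro rfl
  obtain ⟨x, h1, h2⟩ := exists_state_of_pseudoGap_neg hopt hgap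
  simp [h1] at h2

/-- There is a law of the state under which a strictly competitive arm beats the optimal mean
reward, although the reward of the optimal arm keeps its distribution. -/
lemma exists_rewardLaw_eq_of_pseudoGap_neg (hopt : B.IsOptimalArm P kstar)
    (hgap : B.pseudoGap P k kstar < 0) :
    ∃ R : ProbabilityMeasure S,
    B.rewardLaw R kstar = B.rewardLaw P kstar ∧ B.bestMean P < B.mean R k := by
  obtain ⟨x₀, hk₀, hs₀⟩ := exists_state_of_pseudoGap_neg hopt hgap
  have hset : MeasurableSet {x | B.Y kstar x = true} :=
    B.measurable_Y kstar (measurableSet_singleton true)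
  -- Pushing `P` forward along an `f` that preserves `Y kstar` keeps the reward law of `kstar`. The
  -- flag `c` says whether `k` is allowed to fail where `kstar` succeeds, which lowers the
  -- guaranteed mean of `k` from `1` to `1 - μ*`.
  have key (f : S → S) (hf : Measurable f) (hs : ∀ x, B.Y kstar (f x) = B.Y kstar x) (c : Bool)
      (hk : ∀ x, B.Y k (f x) = true ∨ (c = true ∧ B.Y kstar x = true))
      (hc : B.bestMean P < 1 - if c then B.bestMean P else 0) :
      ∃ R : ProbabilityMeasure S,
        B.rewardLaw R kstar = B.rewardLaw P kstar ∧ B.bestMean P < B.mean R k := by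
    refine ⟨P.map hf.aemeasurable, ?_, hc.trans_le ?_⟩
    · rw [rewardLaw, ProbabilityMeasure.toMeasure_map,
        Measure.map_map (B.measurable_Y kstar) hf]
      exact congrArg (fun g => Measure.map g (P : Measure S)) (funext hs)
    · have hint (g : S → Bool) (hg : Measurable g) :
          Integrable (fun x => rewardValue (g x)) (P : Measure S) :=
        Integrable.of_bound ((measurable_of_countable rewardValue).comp hg).aestronglyMeasurable 1
          (Eventually.of_forall fun x => by
            rw [Real.norm_of_nonneg (rewardValue_nonneg _)]; exact rewardValue_le_one _)
      have hmean : B.mean (P.map hf.aemeasurable) k =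
          ∫ x, rewardValue (B.Y k (f x)) ∂(P : Measure S) := by
        rw [mean, ProbabilityMeasure.toMeasure_map, integral_map hf.aemeasurable]
        exact ((measurable_of_countable rewardValue).comp (B.measurable_Y k)).aestronglyMeasurable
      have hle : ∫ x, (1 - if c then rewardValue (B.Y kstar x) else 0) ∂(P : Measure S) ≤
          ∫ x, rewardValue (B.Y k (f x)) ∂(P : Measure S) := by
        refine integral_mono ((integrable_const _).sub ?_)
          (hint _ ((B.measurable_Y k).comp hf)) fun x => ?_
        · cases c
          · simp
          · simpa using hint _ (B.measurable_Y kstar)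
        · rcases hk x with h | ⟨rfl, h⟩
          · have := rewardValue_nonneg (B.Y kstar x)
            simp only [h]
            simp only [rewardValue, if_true] at this ⊢
            split_ifs <;> simp
          · simp only [h, if_true]
            have := rewardValue_nonneg (B.Y k (f x))
            simpa [rewardValue] using this
      rw [hmean]
      refine le_trans (le_of_eq ?_) hle
      cases c
      · simp
      · simp only [if_true]
        rw [integral_sub (integrable_const _) (hint _ (B.measurable_Y kstar)), ← hopt.mean_eq]
        simp [mean]
  by_cases h : ∃ x, B.Y k x = true ∧ B.Y kstar x = true
  · obtain ⟨x₁, hk₁, hs₁⟩ := h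
    refine key (fun x => if B.Y kstar x = true then x₁ else x₀)
      (Measurable.ite hset measurable_const measurable_const) (fun x => ?_) false (fun x => ?_) ?_
    · split_ifs with hx
      · rw [hs₁, hx]
      · rw [hs₀, Bool.eq_false_of_not_eq_true hx]
    · left
      split_ifs <;> assumption
    · simpa using bestMean_lt_one_of_pseudoGap_neg hopt hgap
  -- No state makes both arms succeed, so the pseudo reward at `true` vanishes and the negative
  -- pseudo gap gives `μ* < 1 - μ*`.
  · refine key (fun x => if B.Y kstar x = true then x else x₀)
      (Measurable.ite hset measurable_id measurable_const) (fun x => ?_) true (fun x => ?_) ?_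
    · split_ifs with hx
      · rfl
      · rw [hs₀, Bool.eq_false_of_not_eq_true hx]
    · by_cases hx : B.Y kstar x = true
      · exact Or.inr ⟨rfl, hx⟩
      · left
        rwa [if_neg hx]
    · rw [pseudoGap, expectedPseudoReward_eq, hopt.mean_eq,
        pseudoReward_eq_zero (r := true) fun x hx => by
          by_contra hk
          exact h ⟨x, by simpa using hk, hx⟩] at hgap
      have h2 := mul_le_mul_of_nonneg_left (B.pseudoReward_le_one k kstar false)
        (sub_nonneg.2 (B.bestMean_mem_unitInterval P).2)
      simp only [if_true]
      linarith

lemma exists_isPerturbation_rewardLaw_eq (hopt : B.IsOptimalArm P kstar)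
    (hgap : B.pseudoGap P k kstar < 0) :
    ∃ Q : ProbabilityMeasure S,
    B.IsPerturbation P kstar k Q ∧ B.rewardLaw Q kstar = B.rewardLaw P kstar ∧
      B.bestMean Q < 1 ∧ ∀ i, B.rewardDiv P Q i ≠ ∞ := by
  obtain ⟨R, hR, hk⟩ := exists_rewardLaw_eq_of_pseudoGap_neg hopt hgap
  have h0 := (B.bestMean_mem_unitInterval P).1
  have h1 := bestMean_lt_one_of_pseudoGap_neg hopt hgap
  have h2 := (B.mean_mem_Icc R k).2
  have hδ : 0 < (B.mean R k - B.bestMean P) / 2 := by linarith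
  let δ : unitInterval := ⟨(B.mean R k - B.bestMean P) / 2, hδ.le, by linarith⟩
  have hδ' : (δ : ℝ) < B.mean R k - B.bestMean P := by change _ / 2 < _; linarith
  have : Nonempty (Fin K) := ⟨k⟩
  refine ⟨P.mixture R δ, isPerturbation_mixture hδ ?_ hδ', ?_, ?_, rewardDiv_mixture_ne_top hδ⟩
  · rw [mean_eq_real, hR, ← mean_eq_real, hopt.mean_eq]
  · rw [rewardLaw_mixture, hR, ← add_smul, ← ENNReal.ofReal_add δ.2.1 (sub_nonneg.2 δ.2.2),
      add_sub_cancel, ENNReal.ofReal_one, one_smul]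
  · refine bestMean_lt_of_forall fun i => ?_
    rw [mean_mixture]
    have h3 := mul_lt_mul_of_pos_left
      ((mean_le_bestMean (B := B) (P := P) i).trans_lt h1) (show 0 < (δ : ℝ) from hδ)
    have h4 := mul_le_mul_of_nonneg_left (B.mean_mem_Icc R i).2 (sub_nonneg.2 δ.2.2)
    linarith

lemma exists_isPerturbation_le_rewardDiv (hopt : B.IsOptimalArm P kstar)
    (hgap : B.pseudoGap P k kstar < 0) (L : ℝ) :
    ∃ Q : ProbabilityMeasure S,
    B.IsPerturbation P kstar k Q ∧ L ≤ (B.rewardDiv P Q k).toReal := by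
  obtain ⟨x₀, hk₀, hs₀⟩ := exists_state_of_pseudoGap_neg hopt hgap
  have h0 := (B.bestMean_mem_unitInterval P).1
  have h1 := bestMean_lt_one_of_pseudoGap_neg hopt hgap
  have hkP : 0 < 1 - B.mean P k :=
    sub_pos.2 ((mean_le_bestMean (B := B) (P := P) k).trans_lt h1)
  let R : ProbabilityMeasure S := ⟨Measure.dirac x₀, inferInstance⟩
  have hmean (i : Fin K) : B.mean R i = rewardValue (B.Y i x₀) := by
    rw [mean_eq_real, rewardLaw]
    change ((Measure.dirac x₀).map (B.Y i)).real {true} = _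
    rw [Measure.map_dirac' (B.measurable_Y i), measureReal_def,
      Measure.dirac_apply' _ (measurableSet_singleton _)]
    cases B.Y i x₀ <;> simp [rewardValue]
  have hRk : B.mean R k = 1 := by rw [hmean, hk₀]; simp [rewardValue]
  have hRs : B.mean R kstar = 0 := by rw [hmean, hs₀]; simp [rewardValue]
  -- Chosen so that `le_rewardDiv` returns exactly `L`; a weight `δ ≤ exp (-l)` on `P` makes
  -- failures of `k` that rare.
  set l : ℝ := (L + Real.log 2) / (1 - B.mean P k) with hl
  have hδ : 0 < min ((1 - B.bestMean P) / 2) (Real.exp (-l)) :=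
    lt_min (by linarith) (Real.exp_pos _)
  let δ : unitInterval := ⟨min ((1 - B.bestMean P) / 2) (Real.exp (-l)), hδ.le,
    (min_le_left _ _).trans (by linarith)⟩
  have hδ1 : (δ : ℝ) ≤ (1 - B.bestMean P) / 2 := min_le_left _ _
  have hδ2 : (δ : ℝ) ≤ Real.exp (-l) := min_le_right _ _
  refine ⟨P.mixture R δ, isPerturbation_mixture hδ (hRs.trans_le h0) (by linarith), ?_⟩
  refine le_trans (le_of_eq ?_)
    (le_rewardDiv (rewardDiv_mixture_ne_top (show 0 < (δ : ℝ) from hδ) k) (l := l) ?_)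
  · rw [hl, mul_div_cancel₀ _ hkP.ne']
    ring
  · rw [mean_mixture, hRk]
    have := mul_nonneg δ.2.1 (B.mean_mem_Icc P k).1
    linarith

end Competitive

/-- The regret bound from a perturbation that affects the reward distribution of one arm only. -/
lemma IsPerturbation.exists_log_le_aoiRegret {kstar k : Fin K} {Q : ProbabilityMeasure S}
    (hQ : B.IsPerturbation P kstar k Q) (hk : B.AffectsOnly P k Q)
    (hopt : B.IsOptimalArm P kstar) (hP0 : 0 < B.bestMean P) (hP1 : B.bestMean P < 1)
    {ρ : Policy K} {α : ℝ} (hρ : B.IsConsistent ρ α) :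
    ∃ C : ℝ, ∀ T : ℕ, 1 ≤ T →
      B.gap P k / (B.rewardDiv P Q k).toReal * ((1 - α) * Real.log T - C) ≤
        B.bestMean P * B.aoiRegret P ρ T := by
  have hdiv (i : Fin K) (hi : i ≠ k) : B.rewardDiv P Q i = 0 := by
    rw [rewardDiv, hk i hi, InformationTheory.klDiv_self]
  have : Nonempty (Fin K) := ⟨k⟩
  have hgap := sub_pos.2 (hQ.2.1.trans_le (mean_le_bestMean k))
  refine RewardFunctions.exists_log_le_aoiRegret hopt hP0 hP1
    (bestMean_lt_of_forall fun i => ?_) hgap (fun i => ?_)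
    (div_nonneg (gap_nonneg k) ENNReal.toReal_nonneg) (fun i => ?_) hρ
  · rcases eq_or_ne i k with rfl | hi
    -- Were `k` sure to succeed under `Q`, the finite divergence would make it sure under `P`,
    -- against `μ* < 1`.
    · refine (B.mean_mem_Icc Q i).2.lt_of_ne fun h1 => ?_
      have h2 : (B.rewardPMF Q i false).toReal = 0 := by rw [rewardPMF_false, h1, sub_self]
      rw [ENNReal.toReal_eq_zero_iff, or_iff_left (PMF.apply_ne_top _ _)] at h2
      have h3 : B.rewardPMF P i false = 0 :=
        (InformationTheory.klDiv_ne_top_iff.1 hQ.2.2).1 h2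
      have h4 := rewardPMF_false (B := B) (P := P) i
      rw [h3, ENNReal.toReal_zero] at h4
      linarith [mean_le_bestMean (B := B) (P := P) i]
    · rw [mean_eq_real, hk i hi, ← mean_eq_real]
      exact (mean_le_bestMean i).trans_lt hP1
  · rcases eq_or_ne i k with rfl | hi
    · exact hQ.2.2
    · simp [hdiv i hi]
  · rcases eq_or_ne i k with rfl | hi
    · rw [div_mul_eq_mul_div, mul_div_assoc]
      exact mul_le_of_le_one_right (gap_nonneg i) (div_self_le_one _)
    · simpa [hdiv i hi] using gap_nonneg i

/-- Only `kstar` has zero gap, and its divergence is zero; for the finitely many other arms a small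
`c` works. -/
lemma exists_pos_mul_rewardDiv_le_gap {kstar : Fin K} {Q : ProbabilityMeasure S}
    (hopt : B.IsOptimalArm P kstar) (hQ : B.rewardLaw Q kstar = B.rewardLaw P kstar) :
    ∃ c : ℝ, 0 < c ∧ ∀ i, c * (B.rewardDiv P Q i).toReal ≤ B.gap P i := by
  have h (i : Fin K) : ∀ᶠ c : ℝ in nhdsWithin 0 (Set.Ioi 0),
      c * (B.rewardDiv P Q i).toReal ≤ B.gap P i := by
    rcases eq_or_ne i kstar with rfl | hi
    · refine Eventually.of_forall fun c => ?_
      rw [rewardDiv, hQ, InformationTheory.klDiv_self]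
      simpa using gap_nonneg i
    · have hlim : Tendsto (fun c : ℝ => c * (B.rewardDiv P Q i).toReal) (nhdsWithin 0 (Set.Ioi 0))
          (nhds (0 * (B.rewardDiv P Q i).toReal)) :=
        (tendsto_nhdsWithin_of_tendsto_nhds tendsto_id).mul_const _
      rw [zero_mul] at hlim
      exact (hlim.eventually_lt_const (hopt.gap_pos hi)).mono fun _ => le_of_lt
  obtain ⟨c, hc, hc0⟩ := ((eventually_all.2 h).and self_mem_nhdsWithin).exists
  exact ⟨c, hc0, hc⟩

lemma IsConsistencyConstant.mono {ρ : Policy K} {α M M' : ℝ}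
    (h : B.IsConsistencyConstant P ρ α M) (hM : M ≤ M') : B.IsConsistencyConstant P ρ α M' :=
  fun k hk t => (h k hk t).trans
    (mul_le_mul_of_nonneg_right hM (Real.rpow_nonneg (Nat.cast_nonneg t) α))

end RewardFunctions

/-! ### Assembly of the lower bound -/

theorem theorem1 {K : ℕ} {S : Type*} [MeasurableSpace S] (B : RewardFunctions K S)
    (P : ProbabilityMeasure S) (kstar : Fin K) (hopt : B.IsOptimalArm P kstar)
    (hpos : 0 < B.bestMean P) :
    (∀ hC : (B.strictlyCompetitive P kstar).Nonempty,
      ∃ Q : Fin K → ProbabilityMeasure S,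
        (∀ k ∈ B.strictlyCompetitive P kstar,
          B.IsPerturbation P kstar k (Q k) ∧ (K = 2 → B.AffectsOnly P k (Q k))) ∧
        (∀ Q' : Fin K → ProbabilityMeasure S,
          (∀ k ∈ B.strictlyCompetitive P kstar, Q' k = Q k ∨
            (B.IsPerturbation P kstar k (Q' k) ∧ B.AffectsOnly P k (Q' k))) →
          ∀ (α : ℝ) (ρ : Policy K), B.IsConsistent ρ α →
            ∃ M : ℝ, 0 < M ∧ B.IsConsistencyConstant P ρ α M ∧
              ∀ T : ℕ, 1 ≤ T →
                (B.strictlyCompetitive P kstar).sup' hC (fun k =>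
                  B.gap P k / (B.rewardDiv P (Q' k) k).toReal *
                    (((1 - α) * Real.log T - Real.log (4 * M)) / B.bestMean P))
                  ≤ B.aoiRegret P ρ T) ∧
        (∀ (α : ℝ) (ρ : Policy K), B.IsConsistent ρ α →
          (fun T : ℕ => Real.log T) =O[atTop] (fun T : ℕ => B.aoiRegret P ρ T))) ∧
    ((∀ k, 0 ≤ B.pseudoGap P k kstar) →
      ∀ (ρ : Policy K) (T : ℕ), 0 ≤ B.aoiRegret P ρ T) := by
  refine ⟨fun hC => ?_, fun _ ρ T => RewardFunctions.aoiRegret_nonneg hpos ρ T⟩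
  have hneg (k) (hk : k ∈ B.strictlyCompetitive P kstar) : B.pseudoGap P k kstar < 0 := by
    classical
    simpa [RewardFunctions.strictlyCompetitive] using hk
  obtain ⟨k₀, hk₀⟩ := hC
  have hP1 := RewardFunctions.bestMean_lt_one_of_pseudoGap_neg hopt (hneg k₀ hk₀)
  obtain ⟨Q₀, hQ₀, hlaw₀, hbest₀, hdiv₀⟩ :=
    RewardFunctions.exists_isPerturbation_rewardLaw_eq hopt (hneg k₀ hk₀)
  obtain ⟨c, hc, hcD⟩ := RewardFunctions.exists_pos_mul_rewardDiv_le_gap hopt hlaw₀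
  have hbase (α : ℝ) (ρ : Policy K) (hρ : B.IsConsistent ρ α) :=
    RewardFunctions.exists_log_le_aoiRegret hopt hpos hP1 hbest₀
      (sub_pos.2 (hQ₀.2.1.trans_le (RewardFunctions.mean_le_bestMean k₀))) hdiv₀ hc.le hcD hρ
  -- Either `k` alone is affected and the change of measure gives its own coefficient, or the
  -- divergence is large enough for `hbase` to dominate.
  have hex (k : Fin K) : ∃ Q : ProbabilityMeasure S, k ∈ B.strictlyCompetitive P kstar →
      B.IsPerturbation P kstar k Q ∧ (K = 2 → B.AffectsOnly P k Q) ∧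
        (B.AffectsOnly P k Q ∨ B.gap P k / (B.rewardDiv P Q k).toReal ≤ c) := by
    by_cases hk : k ∈ B.strictlyCompetitive P kstar
    swap
    · exact ⟨P, fun h => absurd h hk⟩
    by_cases hK : K = 2
    · obtain ⟨Q, hQ, hlaw, -, -⟩ :=
        RewardFunctions.exists_isPerturbation_rewardLaw_eq hopt (hneg k hk)
      have haff : B.AffectsOnly P k Q := fun i hi => by
        have hne := RewardFunctions.ne_of_pseudoGap_neg hopt (hneg k hk)
        have : i = kstar := by
          subst hK
          omega
        rw [this, hlaw]
      exact ⟨Q, fun _ => ⟨hQ, fun _ => haff, Or.inl haff⟩⟩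
    · obtain ⟨Q, hQ, hL⟩ := RewardFunctions.exists_isPerturbation_le_rewardDiv hopt (hneg k hk)
        (B.gap P k / c)
      refine ⟨Q, fun _ => ⟨hQ, fun h => absurd h hK, Or.inr ?_⟩⟩
      refine div_le_of_le_mul₀ ENNReal.toReal_nonneg hc.le ?_
      rwa [div_le_iff₀' hc] at hL
  choose Q hQ using hex
  refine ⟨Q, fun k hk => ⟨(hQ k hk).1, (hQ k hk).2.1⟩, fun Q' hQ' α ρ hρ => ?_, fun α ρ hρ => ?_⟩
  · have hbound (k : Fin K) : ∃ C : ℝ, k ∈ B.strictlyCompetitive P kstar → ∀ T : ℕ, 1 ≤ T →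
        B.gap P k / (B.rewardDiv P (Q' k) k).toReal * ((1 - α) * Real.log T - C) ≤
          B.bestMean P * B.aoiRegret P ρ T := by
      by_cases hk : k ∈ B.strictlyCompetitive P kstar
      swap
      · exact ⟨0, fun h => absurd h hk⟩
      have haff (h : B.IsPerturbation P kstar k (Q' k)) (h' : B.AffectsOnly P k (Q' k)) :=
        h.exists_log_le_aoiRegret h' hopt hpos hP1 hρ
      rcases hQ' k hk with h | ⟨h, h'⟩
      · rcases (hQ k hk).2.2 with h' | h'
        · obtain ⟨C, hC⟩ := haff (h ▸ (hQ k hk).1) (h ▸ h')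
          exact ⟨C, fun _ => hC⟩
        · obtain ⟨C, hC⟩ := hbase α ρ hρ
          refine ⟨C, fun _ T hT => ?_⟩
          rw [h]
          -- Lowering the coefficient from `c` is harmless only when the bracket is nonnegative;
          -- otherwise nonnegativity of the regret suffices.
          rcases le_total 0 ((1 - α) * Real.log T - C) with h0 | h0
          · exact (mul_le_mul_of_nonneg_right h' h0).trans (hC T hT)
          · exact (mul_nonpos_of_nonneg_of_nonpos (div_nonneg (RewardFunctions.gap_nonneg k)
              ENNReal.toReal_nonneg) h0).trans
              (mul_nonneg hpos.le (RewardFunctions.aoiRegret_nonneg hpos ρ T))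
      · obtain ⟨C, hC⟩ := haff h h'
        exact ⟨C, fun _ => hC⟩
    choose C hbound using hbound
    obtain ⟨M₀, hM₀⟩ := hρ.2.2 P
    -- Large enough to be a consistency constant and to have `log (4 * M) ≥ C k` for every arm.
    set M : ℝ := max M₀ 1 + ∑ k, Real.exp (C k) with hM
    have hsum : 0 ≤ ∑ k, Real.exp (C k) := Finset.sum_nonneg fun k _ => (Real.exp_pos _).le
    have hM0 : 0 < M := by linarith [le_max_right M₀ 1]
    refine ⟨M, hM0, hM₀.mono (by linarith [le_max_left M₀ 1]), fun T hT => ?_⟩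
    refine Finset.sup'_le _ _ fun k hk => ?_
    have hlog : C k ≤ Real.log (4 * M) := by
      rw [Real.le_log_iff_exp_le (by positivity)]
      have := Finset.single_le_sum (f := fun k => Real.exp (C k)) (fun k _ => (Real.exp_pos _).le)
        (Finset.mem_univ k)
      linarith [le_max_right M₀ 1]
    rw [← mul_div_assoc, div_le_iff₀' hpos]
    refine le_trans (mul_le_mul_of_nonneg_left ?_ (div_nonneg (RewardFunctions.gap_nonneg k)
      ENNReal.toReal_nonneg)) (hbound k hk T hT)
    linarith
  · obtain ⟨C, hC⟩ := hbase α ρ hρ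
    have hα : 0 < 1 - α := sub_pos.2 hρ.2.1
    refine Asymptotics.IsBigO.of_bound (2 * B.bestMean P / (c * (1 - α))) ?_
    filter_upwards [eventually_ge_atTop 1, (Real.tendsto_log_atTop.comp
      -- Beyond this threshold `C` is at most half of `(1 - α) log T`, whence the factor `2` in the
      -- constant.
      tendsto_natCast_atTop_atTop).eventually_ge_atTop (2 * C / (1 - α))] with T hT hlarge
    rw [Real.norm_of_nonneg (Real.log_natCast_nonneg T),
      Real.norm_of_nonneg (RewardFunctions.aoiRegret_nonneg hpos ρ T), div_mul_eq_mul_div,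
      le_div_iff₀ (mul_pos hc hα)]
    rw [Function.comp_apply, div_le_iff₀' hα] at hlarge
    have h1 := mul_le_mul_of_nonneg_left hlarge hc.le
    linarith [hC T hT]
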